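/- Let $f(x)=\frac1n\sum_{i=1}^n f(x,\xi_i)$, $x\in\mathbb R^d$, be the average of the losses $f(\cdot,\xi_i)$ on $n\ge 1$ data points. For a minibatch $\xi$ of $b\ge1$ data points let $f(x,\xi)$ denote the average of the losses of its members. LightSAM-II (AdaGrad) with perturbation radius $\rho\ge 0$, learning rate $\eta>0$ and $\epsilon>0$ starts at a deterministic point $x_1\in\mathbb R^d$ with $u_0=v_0=(\epsilon^2,\dots,\epsilon^2)\in\mathbb R^d$ and, for $t=1,2,\dots$, draws a minibatch $\xi_t$ and sets, coordinate-wise, $$s_t=\nabla f(x_t,\xi_t),\quad u_t=u_{t-1}+s_t\odot s_t,\quad w_t=x_t+\rho\,\tfrac{1}{\sqrt{u_t}}\odot s_t,$$ $$g_t=\nabla f(w_t,\xi_t),\quad v_t=v_{t-1}+g_t\odot g_t,\quad x_{t+1}=x_t-\eta\,\tfrac{1}{\sqrt{v_t}}\odot g_t .$$ The minibatches $\xi_1,\xi_2,\dots$ are independent, and each member of a minibatch is uniformly distributed on the data set (drawn with or without replacement). Assume that $f$ is bounded below with $f(x_1)-\inf f\le\Delta$, and that there are constants $L\ge 0$ and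 $D_0,D_1>0$ such that 1. (coordinate-wise $L$-smoothness) for every minibatch $\xi$ that occurs with positive probability, $f(\cdot,\xi)$ is differentiable and $|\nabla f(x,\xi)_l-\nabla f(y,\xi)_l|\le L|x_l-y_l|$ for all $x,y\in\mathbb R^d$ and all $l\in\{1,\dots,d\}$; 2. (coordinate-wise affine noise variance) $\mathbb E\big[\nabla f(x,\xi_t)_l^2\big]\le D_0+D_1\nabla f(x)_l^2$ for all $t\ge 1$, $x\in\mathbb R^d$ and $l\in\{1,\dots,d\}$. Then, for every $\rho\ge0$ and $\eta>0$, there is a constant $C$, depending only on $d,\rho,\eta,\epsilon,L,D_0,D_1,\Delta$, such that for all $T\ge 2$ $$\frac1T\sum_{t=1}^T\mathbb E\|\nabla f(x_t)\|_1\le C\,\frac{\ln T}{T^{1/4}},$$ all these expectations being finite. -/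

import Mathlib

open MeasureTheory ProbabilityTheory

namespace LightSAM

/-- The training objective `f(x) = (1/n) ∑ᵢ f(x, ξᵢ)`; here `f i x` is the loss of the weights `x`
on the `i`-th data point. -/
noncomputable def objective {d n : ℕ} (f : Fin n → EuclideanSpace ℝ (Fin d) → ℝ)
    (x : EuclideanSpace ℝ (Fin d)) : ℝ :=
  (1 / (n : ℝ)) * ∑ i, f i x

/-- The loss on a minibatch `B` of `b` data points (given by their indices, in order of drawing):
the average of the losses on its members. -/
noncomputable def batchLoss {d n b : ℕ} (f : Fin n → EuclideanSpace ℝ (Fin d) → ℝ)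
    (B : Fin b → Fin n) (x : EuclideanSpace ℝ (Fin d)) : ℝ :=
  (1 / (b : ℝ)) * ∑ j, f (B j) x

/-- `ξ 0, ξ 1, …` are minibatches drawn independently of each other, each member of each minibatch
being uniformly distributed on the data set. Inside a minibatch the joint law is free, so that
drawing with and drawing without replacement are both covered. -/
structure IsMinibatchSampling {Ω : Type*} [MeasurableSpace Ω] (μ : Measure Ω) {n b : ℕ}
    (ξ : ℕ → Ω → Fin b → Fin n) : Prop where
  measurable : ∀ t, Measurable (ξ t)
  indep : iIndepFun ξ μ
  uniform : ∀ t j i, μ.real {ω | ξ t ω j = i} = 1 / (n : ℝ)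

/-- Coordinate-wise `L`-smoothness. -/
def CoordSmooth {d : ℕ} (L : ℝ) (F : EuclideanSpace ℝ (Fin d) → ℝ) : Prop :=
  Differentiable ℝ F ∧ ∀ x y l, |gradient F x l - gradient F y l| ≤ L * |x l - y l|

/-- The `ℓ¹` norm of a vector. -/
def l1Norm {d : ℕ} (x : EuclideanSpace ℝ (Fin d)) : ℝ :=
  ∑ l, |x l|

/-- What the algorithm carries from one iteration to the next: the weights and the accumulated
coordinate-wise squares of the two stochastic gradients. -/
structure State (d : ℕ) where
  x : EuclideanSpace ℝ (Fin d)
  u : Fin d → ℝ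
  v : Fin d → ℝ

/-- The coordinate-wise scaled vector `s / √u`. -/
noncomputable def scaled {d : ℕ} (u : Fin d → ℝ) (s : EuclideanSpace ℝ (Fin d)) :
    EuclideanSpace ℝ (Fin d) :=
  WithLp.toLp 2 fun l => s l / √(u l)

/-- One iteration of LightSAM-II on the minibatch loss `F`, with perturbation radius `ρ` and
learning rate `η`. -/
noncomputable def step {d : ℕ} (ρ η : ℝ) (F : EuclideanSpace ℝ (Fin d) → ℝ) (S : State d) :
    State d :=
  let s := gradient F S.x
  let u : Fin d → ℝ := fun l => S.u l + s l ^ 2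
  let w := S.x + ρ • scaled u s
  let g := gradient F w
  let v : Fin d → ℝ := fun l => S.v l + g l ^ 2
  { x := S.x - η • scaled v g, u := u, v := v }

/-- The state of LightSAM-II after `t` iterations, i.e. `(x_{t+1}, u_t, v_t)`, when started at `x₁`
with `u₀ = v₀ = ε²` in every coordinate; iteration `t + 1` uses the minibatch `B t`. -/
noncomputable def state {d n b : ℕ} (ρ η ε : ℝ) (f : Fin n → EuclideanSpace ℝ (Fin d) → ℝ)
    (x₁ : EuclideanSpace ℝ (Fin d)) (B : ℕ → Fin b → Fin n) : ℕ → State d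
  | 0 => { x := x₁, u := fun _ => ε ^ 2, v := fun _ => ε ^ 2 }
  | t + 1 => step ρ η (batchLoss f (B t)) (state ρ η ε f x₁ B t)

/-- The weights `x_t`, for `t ≥ 1`. -/
noncomputable def iterate {d n b : ℕ} (ρ η ε : ℝ) (f : Fin n → EuclideanSpace ℝ (Fin d) → ℝ)
    (x₁ : EuclideanSpace ℝ (Fin d)) (B : ℕ → Fin b → Fin n) (t : ℕ) :
    EuclideanSpace ℝ (Fin d) :=
  (state ρ η ε f x₁ B (t - 1)).x

end LightSAM

/-! ### One-variable smoothness and the descent inequality of a single coordinate. -/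

namespace LightSAM

/-! Coordinate-wise smoothness at two points sharing their `l`-th coordinate forces equal `l`-th
partial derivatives. So each gradient coordinate is a function of that coordinate alone, and the
algorithm splits into `d` scalar AdaGrad runs, each on the restriction `F` of the objective to a
coordinate line.

In a scalar run the descent term `-F'(x_t) g_t / √v_{t+1}` has a denominator correlated with `g_t`.
Replacing it by `√v_t` costs, by Young's inequality, a multiple of `F'(x_t)² g_t² / √v_t` with small
expectation, plus a multiple of `1/√v_t - 1/√v_{t+1}` weighted by `A₀ + A₁ F'(x_t)²`, which
telescopes once put into a potential (`potential_step`, `potential_decrease`). The SAM perturbation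
and the second-order terms leave `s_t²/u_{t+1}` and `g_t²/v_{t+1}`, whose sums are logarithmic.

Hence `S = ∑ E[F'(x_t)²/√v_t]` is at most a constant plus a multiple of an expected logarithm of the
accumulator (`sum_sq_le`), while the expected root `Y` of the accumulator is `O(√T + S)`
(`sqrt_le`). Solving the two together (`exists_bound_of_coupled`) gives `S = O(log T)` and `Y = O(√T
log T)`, and weighted AM-GM (`sum_abs_le`) turns this into the rate for `|F'|`. -/

/-- Second-order upper bound for a function with Lipschitz derivative. -/
theorem le_add_deriv_mul_add_sq {F F' : ℝ → ℝ} {L : ℝ} (hF : ∀ z, HasDerivAt F (F' z) z)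
    (hL : ∀ y z, |F' y - F' z| ≤ L * |y - z|) (y z : ℝ) :
    F y ≤ F z + F' z * (y - z) + L * (y - z) ^ 2 := by
  have hL0 : y ≠ z → 0 ≤ L := by
    intro h
    by_contra hneg
    push Not at hneg
    have h1 := hL y z
    have h2 : 0 < |y - z| := abs_pos.mpr (sub_ne_zero.mpr h)
    nlinarith [abs_nonneg (F' y - F' z)]
  have key : ∀ c, |c - z| ≤ |y - z| → (F' c - F' z) * (y - z) ≤ L * (y - z) ^ 2 := by
    intro c hc
    by_cases hyz : y = z
    · subst hyz; simp
    calc (F' c - F' z) * (y - z) ≤ |F' c - F' z| * |y - z| := by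
          rw [← abs_mul]; exact le_abs_self _
      _ ≤ (L * |y - z|) * |y - z| := by
          gcongr
          exact (hL c z).trans (mul_le_mul_of_nonneg_left hc (hL0 hyz))
      _ = L * (y - z) ^ 2 := by rw [mul_assoc, abs_mul_abs_self]; ring
  have hcont : Continuous F := continuous_iff_continuousAt.mpr fun z => (hF z).continuousAt
  rcases lt_trichotomy z y with h | h | h
  · obtain ⟨c, hc, hc'⟩ := exists_hasDerivAt_eq_slope F F' h hcont.continuousOn fun x _ => hF x
    have := key c (by
      rw [abs_of_pos (sub_pos.mpr hc.1), abs_of_pos (sub_pos.mpr h)]; linarith [hc.2])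
    rw [eq_div_iff (sub_pos.mpr h).ne'] at hc'
    nlinarith
  · subst h; simp
  · obtain ⟨c, hc, hc'⟩ := exists_hasDerivAt_eq_slope F F' h hcont.continuousOn fun x _ => hF x
    have := key c (by
      rw [abs_of_neg (sub_neg.mpr hc.2), abs_of_neg (sub_neg.mpr h)]; linarith [hc.1])
    rw [eq_div_iff (sub_pos.mpr h).ne'] at hc'
    nlinarith

/-- A function with Lipschitz derivative that cannot decrease by more than `Δ` has a small slope. -/
theorem deriv_sq_le {F F' : ℝ → ℝ} {L Δ x₀ : ℝ} (hL0 : 0 ≤ L) (hF : ∀ z, HasDerivAt F (F' z) z)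
    (hL : ∀ y z, |F' y - F' z| ≤ L * |y - z|) (hΔ : ∀ z, F x₀ - F z ≤ Δ) :
    F' x₀ ^ 2 ≤ 4 * (L + 1) * Δ := by
  -- One gradient step from `x₀`; `L + 1` in place of `L` keeps the step length finite when `L = 0`.
  have h1 := le_add_deriv_mul_add_sq hF hL (x₀ - F' x₀ / (2 * (L + 1))) x₀
  have h2 := hΔ (x₀ - F' x₀ / (2 * (L + 1)))
  set r := 1 / (2 * (L + 1)) with hr
  have hr0 : 0 < r := by positivity
  have e : F' x₀ / (2 * (L + 1)) = r * F' x₀ := by rw [hr]; ring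
  rw [e] at h1 h2
  have hLr : L * r ≤ 1 / 2 := by
    rw [hr, mul_one_div, div_le_iff₀ (by positivity)]; linarith
  have h3 : r * F' x₀ ^ 2 / 2 ≤ Δ := by
    have : L * r * (r * F' x₀ ^ 2) ≤ 1 / 2 * (r * F' x₀ ^ 2) := by gcongr
    nlinarith
  have h4 : F' x₀ ^ 2 = 4 * (L + 1) * (r * F' x₀ ^ 2 / 2) := by
    rw [hr]; field_simp; ring
  rw [h4]; gcongr

/-- The trajectory of one coordinate of LightSAM-II during the first `T` iterations: position,
gradient, gradient at the perturbed point, and the two accumulated sums of squares. -/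
structure IsScalarRun (ρ η ε L x₀ : ℝ) (T : ℕ) (x s g u v : ℕ → ℝ) : Prop where
  x_zero : x 0 = x₀
  u_zero : u 0 = ε ^ 2
  v_zero : v 0 = ε ^ 2
  u_succ : ∀ t < T, u (t + 1) = u t + s t ^ 2
  v_succ : ∀ t < T, v (t + 1) = v t + g t ^ 2
  x_succ : ∀ t < T, x (t + 1) = x t - η * (g t / √(v (t + 1)))
  close : ∀ t < T, |g t - s t| ≤ L * (ρ * (|s t| / √(u (t + 1))))

/-- Young's inequality on `a (g - s)` replaces `g` by the unbiased `s`. Bounding `1/q` by `1/ε` in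
the remainder leaves `s²/p²`, which is summable to a logarithm when `p² = u_{t+1}`. -/
theorem neg_mul_div_le {a s g q p c ε : ℝ} (hε : 0 < ε) (hq : ε ≤ q) (hp : 0 < p)
    (hc : |g - s| ≤ c * (|s| / p)) :
    -(a * g / q) ≤ -(a * s / q) + a ^ 2 / (8 * q) + 2 * c ^ 2 / ε * (s ^ 2 / p ^ 2) := by
  have hq0 : 0 < q := hε.trans_le hq
  have h1 : -(a * (g - s)) ≤ a ^ 2 / 8 + 2 * (g - s) ^ 2 := by
    nlinarith [sq_nonneg (a + 4 * (g - s))]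
  have h2 : (g - s) ^ 2 ≤ c ^ 2 * (s ^ 2 / p ^ 2) := by
    calc (g - s) ^ 2 = |g - s| ^ 2 := (sq_abs _).symm
      _ ≤ (c * (|s| / p)) ^ 2 := by gcongr
      _ = c ^ 2 * (s ^ 2 / p ^ 2) := by rw [mul_pow, div_pow, sq_abs]
  have h3 : -(a * (g - s)) / q ≤ (a ^ 2 / 8 + 2 * (c ^ 2 * (s ^ 2 / p ^ 2))) / q := by
    gcongr; linarith
  have h4 : 2 * (c ^ 2 * (s ^ 2 / p ^ 2)) / q ≤ 2 * (c ^ 2 * (s ^ 2 / p ^ 2)) / ε := by gcongr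
  have e1 : -(a * (g - s)) / q = -(a * g / q) + a * s / q := by ring
  have e2 : (a ^ 2 / 8 + 2 * (c ^ 2 * (s ^ 2 / p ^ 2))) / q
      = a ^ 2 / (8 * q) + 2 * (c ^ 2 * (s ^ 2 / p ^ 2)) / q := by field_simp
  have e3 : 2 * (c ^ 2 * (s ^ 2 / p ^ 2)) / ε = 2 * c ^ 2 / ε * (s ^ 2 / p ^ 2) := by ring
  linarith

/-- The price of decorrelating the denominator. With `r = 1/q - 1/q'`, Young's inequality leaves `2
M q r²`, and `q r ≤ 1` makes this linear in `r`, hence telescoping. -/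
theorem mul_sub_inv_le {a g q q' M : ℝ} (hq : 0 < q) (hqq : q ≤ q') (hM : 0 < M) :
    a * g * (1 / q - 1 / q') ≤ a ^ 2 * g ^ 2 / (8 * (M * q)) + 2 * M * (1 / q - 1 / q') := by
  set r := 1 / q - 1 / q' with hr
  have hq' : 0 < q' := hq.trans_le hqq
  have hr0 : 0 ≤ r := sub_nonneg.mpr (one_div_le_one_div_of_le hq hqq)
  have hqr : q * r ≤ 1 := by
    have : q * r = 1 - q / q' := by rw [hr]; field_simp
    have : 0 ≤ q / q' := by positivity
    linarith
  have h1 : 2 * M * (q * r) * r ≤ 2 * M * 1 * r := by gcongr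
  have h2 : a * g * r ≤ a ^ 2 * g ^ 2 / (8 * (M * q)) + 2 * (M * q) * r ^ 2 := by
    have hMq : 0 < M * q := by positivity
    set m := M * q
    have : a ^ 2 * g ^ 2 / (8 * m) + 2 * m * r ^ 2 - a * g * r
        = (a * g - 4 * m * r) ^ 2 / (8 * m) := by field_simp; ring
    have : 0 ≤ (a * g - 4 * m * r) ^ 2 / (8 * m) := by positivity
    linarith
  nlinarith

/-- The telescoping weight contains `F'(x_t)²`, which changes with `t`. The change of `F'` is at
most `κ |g|/q'`, so Young's inequality moves the drift into an absorbable share of `a²/q` and a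
summable term. -/
theorem sq_sub_sq_div_le {a a' g q q' A κ ε : ℝ} (hA : 0 ≤ A) (hε : 0 < ε) (hq : ε ≤ q)
    (hqq : q ≤ q') (ha : |a' - a| ≤ κ * (|g| / q')) :
    2 * A * ((a' ^ 2 - a ^ 2) / q')
      ≤ a ^ 2 / (8 * q) + (32 * A ^ 2 + 2 * A) * κ ^ 2 / ε * (g ^ 2 / q' ^ 2) := by
  have hq0 : 0 < q := hε.trans_le hq
  have hq' : 0 < q' := hq0.trans_le hqq
  have h2 : (a' - a) ^ 2 ≤ κ ^ 2 * (g ^ 2 / q' ^ 2) := by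
    calc (a' - a) ^ 2 = |a' - a| ^ 2 := (sq_abs _).symm
      _ ≤ (κ * (|g| / q')) ^ 2 := by gcongr
      _ = κ ^ 2 * (g ^ 2 / q' ^ 2) := by rw [mul_pow, div_pow, sq_abs]
  have h1 : 2 * A * (a' ^ 2 - a ^ 2) ≤ a ^ 2 / 8 + (32 * A ^ 2 + 2 * A) * (a' - a) ^ 2 := by
    nlinarith [sq_nonneg (a - 16 * A * (a' - a))]
  have h3 : 2 * A * (a' ^ 2 - a ^ 2)
      ≤ a ^ 2 / 8 + (32 * A ^ 2 + 2 * A) * (κ ^ 2 * (g ^ 2 / q' ^ 2)) := by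
    refine h1.trans ?_
    gcongr
  calc 2 * A * ((a' ^ 2 - a ^ 2) / q') = 2 * A * (a' ^ 2 - a ^ 2) / q' := by ring
    _ ≤ (a ^ 2 / 8 + (32 * A ^ 2 + 2 * A) * (κ ^ 2 * (g ^ 2 / q' ^ 2))) / q' := by gcongr
    _ = a ^ 2 / 8 / q' + (32 * A ^ 2 + 2 * A) * (κ ^ 2 * (g ^ 2 / q' ^ 2)) / q' := add_div _ _ _
    _ ≤ a ^ 2 / 8 / q + (32 * A ^ 2 + 2 * A) * (κ ^ 2 * (g ^ 2 / q' ^ 2)) / ε := by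
        gcongr
        exact hq.trans hqq
    _ = _ := by rw [div_div]; ring

/-- The decrease of the potential `F x + η (2 A₀ + 2 A₁ F'(x)²) / √v` in one iteration. -/
theorem potential_step {a a' s g q q' p F₀ F₁ A₀ A₁ c κ η ε L : ℝ} (hA₀ : 0 < A₀) (hA₁ : 0 ≤ A₁)
    (hη : 0 < η) (hε : 0 < ε) (hq : ε ≤ q) (hqq : q ≤ q') (hp : 0 < p)
    (hgs : |g - s| ≤ c * (|s| / p)) (hg : g ^ 2 ≤ 2 * s ^ 2 + 2 * c ^ 2)
    (ha : |a' - a| ≤ κ * (|g| / q'))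
    (hF : F₁ ≤ F₀ + a * (-(η * (g / q'))) + L * (-(η * (g / q'))) ^ 2) :
    (F₁ + η * ((2 * A₀ + 2 * A₁ * a' ^ 2) / q')) - (F₀ + η * ((2 * A₀ + 2 * A₁ * a ^ 2) / q))
      ≤ η * (-(a / q * s) + 1 / 4 * (a ^ 2 / q)
          + a ^ 2 / (4 * ((A₀ + A₁ * a ^ 2) * q)) * s ^ 2
          + c ^ 2 * (a ^ 2 / (4 * ((A₀ + A₁ * a ^ 2) * q)))
          + (L * η + (32 * A₁ ^ 2 + 2 * A₁) * κ ^ 2 / ε) * (g ^ 2 / q' ^ 2)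
          + 2 * c ^ 2 / ε * (s ^ 2 / p ^ 2)) := by
  have hq0 : 0 < q := hε.trans_le hq
  have hq' : 0 < q' := hq0.trans_le hqq
  have hM : 0 < A₀ + A₁ * a ^ 2 := by positivity
  have h1 := neg_mul_div_le (a := a) hε hq hp hgs
  have h2 := mul_sub_inv_le (a := a) (g := g) hq0 hqq hM
  have h3 := sq_sub_sq_div_le (a := a) hA₁ hε hq hqq ha
  set M := A₀ + A₁ * a ^ 2 with hMdef
  have h4 : a ^ 2 * g ^ 2 / (8 * (M * q))
      ≤ a ^ 2 / (4 * (M * q)) * s ^ 2 + c ^ 2 * (a ^ 2 / (4 * (M * q))) := by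
    calc a ^ 2 * g ^ 2 / (8 * (M * q)) ≤ a ^ 2 * (2 * s ^ 2 + 2 * c ^ 2) / (8 * (M * q)) := by
          gcongr
      _ = _ := by field_simp; ring
  have e1 : (2 * A₀ + 2 * A₁ * a' ^ 2) / q' - (2 * A₀ + 2 * A₁ * a ^ 2) / q
      = 2 * A₁ * ((a' ^ 2 - a ^ 2) / q') - 2 * M * (1 / q - 1 / q') := by
    rw [hMdef]; field_simp; ring
  have e2 : -(a * (g / q')) = -(a * g / q) + a * g * (1 / q - 1 / q') := by field_simp; ring
  have e3 : L * (-(η * (g / q'))) ^ 2 = η * (L * η * (g ^ 2 / q' ^ 2)) := by ring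
  have e4 : a ^ 2 / (8 * q) = 1 / 8 * (a ^ 2 / q) := by field_simp
  have e5 : a * s / q = a / q * s := by ring
  have h5 : -(a * (g / q')) + ((2 * A₀ + 2 * A₁ * a' ^ 2) / q' - (2 * A₀ + 2 * A₁ * a ^ 2) / q)
      + L * η * (g ^ 2 / q' ^ 2)
      ≤ (-(a / q * s) + 1 / 4 * (a ^ 2 / q)
          + a ^ 2 / (4 * (M * q)) * s ^ 2
          + c ^ 2 * (a ^ 2 / (4 * (M * q)))
          + (L * η + (32 * A₁ ^ 2 + 2 * A₁) * κ ^ 2 / ε) * (g ^ 2 / q' ^ 2)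
          + 2 * c ^ 2 / ε * (s ^ 2 / p ^ 2)) := by
    rw [e1, e2]
    rw [e4] at h1 h3
    rw [e5] at h1
    linarith
  have h6 := mul_le_mul_of_nonneg_left h5 hη.le
  rw [e3] at hF
  linarith

/-! ### Pathwise bounds on the accumulators. -/

theorem div_le_log_sub_log {a b : ℝ} (ha : 0 < a) (hb : 0 ≤ b) :
    b / (a + b) ≤ Real.log (a + b) - Real.log a := by
  have hab : 0 < a + b := by positivity
  have := Real.log_le_sub_one_of_pos (div_pos ha hab)
  rw [Real.log_div ha.ne' hab.ne'] at this
  have e : a / (a + b) - 1 = -(b / (a + b)) := by field_simp; ring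
  linarith

theorem sqrt_add_le {a b : ℝ} (ha : 0 < a) (hb : 0 ≤ b) : √(a + b) ≤ √a + b / √a := by
  have h : 0 < √a := Real.sqrt_pos.mpr ha
  rw [Real.sqrt_le_left (by positivity)]
  have : (√a + b / √a) ^ 2 = √a ^ 2 + 2 * b + (b / √a) ^ 2 := by field_simp; ring
  rw [this, Real.sq_sqrt ha.le]
  nlinarith [sq_nonneg (b / √a)]

theorem sum_one_div_sqrt_le (T : ℕ) : ∑ t ∈ Finset.range T, 1 / √((t : ℝ) + 1) ≤ 2 * √T := by
  induction T with
  | zero => simp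
  | succ n ih =>
    rw [Finset.sum_range_succ]
    push_cast
    have h1 : 0 < √((n : ℝ) + 1) := by positivity
    have h3 : √(n : ℝ) ^ 2 = n := Real.sq_sqrt (by positivity)
    have h4 : √((n : ℝ) + 1) ^ 2 = n + 1 := Real.sq_sqrt (by positivity)
    have : 1 / √((n : ℝ) + 1) ≤ 2 * √((n : ℝ) + 1) - 2 * √n := by
      rw [div_le_iff₀ h1]
      nlinarith [sq_nonneg (√((n : ℝ) + 1) - √n)]
    linarith

namespace IsScalarRun

variable {ρ η ε L x₀ : ℝ} {T : ℕ} {x s g u v : ℕ → ℝ}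

theorem sq_le_u (h : IsScalarRun ρ η ε L x₀ T x s g u v) {t : ℕ} (ht : t ≤ T) : ε ^ 2 ≤ u t := by
  induction t with
  | zero => exact h.u_zero.ge
  | succ t ih => rw [h.u_succ t ht]; nlinarith [ih (Nat.le_of_succ_le ht), sq_nonneg (s t)]

theorem sq_le_v (h : IsScalarRun ρ η ε L x₀ T x s g u v) {t : ℕ} (ht : t ≤ T) : ε ^ 2 ≤ v t := by
  induction t with
  | zero => exact h.v_zero.ge
  | succ t ih => rw [h.v_succ t ht]; nlinarith [ih (Nat.le_of_succ_le ht), sq_nonneg (g t)]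

theorem v_le_last (h : IsScalarRun ρ η ε L x₀ T x s g u v) {t : ℕ} (ht : t ≤ T) : v t ≤ v T := by
  induction T, ht using Nat.le_induction with
  | base => exact le_rfl
  | succ n hn ih =>
    have h' : IsScalarRun ρ η ε L x₀ n x s g u v :=
      ⟨h.x_zero, h.u_zero, h.v_zero, fun t ht => h.u_succ t (ht.trans n.lt_succ_self),
        fun t ht => h.v_succ t (ht.trans n.lt_succ_self),
        fun t ht => h.x_succ t (ht.trans n.lt_succ_self),
        fun t ht => h.close t (ht.trans n.lt_succ_self)⟩
    rw [h.v_succ n n.lt_succ_self]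
    nlinarith [ih h', sq_nonneg (g n)]

theorem le_sqrt_v (h : IsScalarRun ρ η ε L x₀ T x s g u v) {t : ℕ} (ht : t ≤ T) :
    ε ≤ √(v t) := Real.le_sqrt_of_sq_le (h.sq_le_v ht)

/-- Since `u (t + 1)` already contains `s t ^ 2`, the normalized gradient is at most 1 in absolute
value, so the perturbation never exceeds `ρ`. -/
theorem sq_sub_le (h : IsScalarRun ρ η ε L x₀ T x s g u v) (hε : 0 < ε) (hL : 0 ≤ L) (hρ : 0 ≤ ρ)
    {t : ℕ} (ht : t < T) : (g t - s t) ^ 2 ≤ (L * ρ) ^ 2 := by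
  have hu : 0 < u (t + 1) := (by positivity : 0 < ε ^ 2).trans_le (h.sq_le_u ht)
  have h1 : |s t| / √(u (t + 1)) ≤ 1 := by
    rw [div_le_one (Real.sqrt_pos.mpr hu)]
    apply Real.abs_le_sqrt
    rw [h.u_succ t ht]
    have := (by positivity : 0 ≤ ε ^ 2).trans (h.sq_le_u ht.le)
    linarith
  have h2 : |g t - s t| ≤ L * ρ := by
    refine (h.close t ht).trans ?_
    calc L * (ρ * (|s t| / √(u (t + 1)))) ≤ L * (ρ * 1) := by gcongr
      _ = L * ρ := by ring
  rw [← sq_abs]; gcongr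

theorem g_sq_le (h : IsScalarRun ρ η ε L x₀ T x s g u v) (hε : 0 < ε) (hL : 0 ≤ L) (hρ : 0 ≤ ρ)
    {t : ℕ} (ht : t < T) : g t ^ 2 ≤ 2 * s t ^ 2 + 2 * (L * ρ) ^ 2 := by
  nlinarith [h.sq_sub_le hε hL hρ ht, sq_nonneg (g t - 2 * s t)]

/-- Lets the logarithm of `u`, produced by the perturbation error, be controlled by `v` alone. -/
theorem u_le (h : IsScalarRun ρ η ε L x₀ T x s g u v) (hε : 0 < ε) (hL : 0 ≤ L) (hρ : 0 ≤ ρ)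
    {t : ℕ} (ht : t ≤ T) : u t ≤ 2 * v t + 2 * (L * ρ) ^ 2 * t := by
  induction t with
  | zero => rw [h.u_zero, h.v_zero]; push_cast; nlinarith [sq_nonneg ε]
  | succ t ih =>
    rw [h.u_succ t ht, h.v_succ t ht]
    push_cast
    nlinarith [h.sq_sub_le hε hL hρ ht, sq_nonneg (s t - 2 * g t), ih (Nat.le_of_succ_le ht)]

theorem sum_g_le (h : IsScalarRun ρ η ε L x₀ T x s g u v) (hε : 0 < ε) {t : ℕ} (ht : t ≤ T) :
    ∑ i ∈ Finset.range t, g i ^ 2 / v (i + 1) ≤ Real.log (v t) - Real.log (ε ^ 2) := by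
  induction t with
  | zero => simp [h.v_zero]
  | succ t ih =>
    have hv := (by positivity : 0 < ε ^ 2).trans_le (h.sq_le_v (Nat.le_of_succ_le ht))
    have := div_le_log_sub_log hv (sq_nonneg (g t))
    rw [Finset.sum_range_succ, h.v_succ t ht]
    linarith [ih (Nat.le_of_succ_le ht)]

theorem sum_s_le (h : IsScalarRun ρ η ε L x₀ T x s g u v) (hε : 0 < ε) {t : ℕ} (ht : t ≤ T) :
    ∑ i ∈ Finset.range t, s i ^ 2 / u (i + 1) ≤ Real.log (u t) - Real.log (ε ^ 2) := by
  induction t with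
  | zero => simp [h.u_zero]
  | succ t ih =>
    have hv := (by positivity : 0 < ε ^ 2).trans_le (h.sq_le_u (Nat.le_of_succ_le ht))
    have := div_le_log_sub_log hv (sq_nonneg (s t))
    rw [Finset.sum_range_succ, h.u_succ t ht]
    linarith [ih (Nat.le_of_succ_le ht)]

end IsScalarRun

end LightSAM

/-! ### One coordinate in expectation. -/

namespace LightSAM

/-- A random trajectory of one coordinate of LightSAM-II for the one-dimensional objective `F` with
derivative `F'`. Randomness is modelled by a positive linear functional `E` on the functions of the
sample `k`; `good` carries all the mass. -/
structure IsRandomScalarRun {K : Type} (ρ η ε L D₀ D₁ Δ x₀ : ℝ) (F F' : ℝ → ℝ)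
    (E : (K → ℝ) →ₗ[ℝ] ℝ) (good : Set K) (T : ℕ) (x s g u v : ℕ → K → ℝ) : Prop where
  hasDerivAt : ∀ z, HasDerivAt F (F' z) z
  lipschitz : ∀ y z, |F' y - F' z| ≤ L * |y - z|
  gap : ∀ z, F x₀ - F z ≤ Δ
  mono : ∀ X Y : K → ℝ, (∀ k ∈ good, X k ≤ Y k) → E X ≤ E Y
  one : E (fun _ => 1) = 1
  run : ∀ k ∈ good, IsScalarRun ρ η ε L x₀ T (x · k) (s · k) (g · k) (u · k) (v · k)
  mean : ∀ t < T, ∀ φ : ℝ → ℝ → ℝ,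
    E (fun k => φ (x t k) (v t k) * s t k) = E (fun k => φ (x t k) (v t k) * F' (x t k))
  second : ∀ t < T, ∀ φ : ℝ → ℝ → ℝ, (∀ y z, 0 ≤ φ y z) →
    E (fun k => φ (x t k) (v t k) * s t k ^ 2)
      ≤ E (fun k => φ (x t k) (v t k) * (D₀ + D₁ * F' (x t k) ^ 2))

namespace IsRandomScalarRun

variable {K : Type} {ρ η ε L D₀ D₁ Δ x₀ : ℝ} {F F' : ℝ → ℝ} {E : (K → ℝ) →ₗ[ℝ] ℝ} {good : Set K}
  {T : ℕ} {x s g u v : ℕ → K → ℝ}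

theorem const (h : IsRandomScalarRun ρ η ε L D₀ D₁ Δ x₀ F F' E good T x s g u v) (c : ℝ) :
    E (fun _ => c) = c := by
  have : (fun _ : K => c) = c • (fun _ : K => (1 : ℝ)) := by ext; simp
  rw [this, map_smul, h.one]; simp

theorem pos_v (h : IsRandomScalarRun ρ η ε L D₀ D₁ Δ x₀ F F' E good T x s g u v) (hε : 0 < ε)
    {k : K} (hk : k ∈ good) {t : ℕ} (ht : t ≤ T) : 0 < v t k :=
  (by positivity : 0 < ε ^ 2).trans_le ((h.run k hk).sq_le_v ht)

/-- In expectation `potential_step` has the descent term `-Q`, against errors of `1/4` from the two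
Young inequalities and `1/8` from the second moment of `s`; at least half of `Q` survives. -/
theorem potential_decrease (h : IsRandomScalarRun ρ η ε L D₀ D₁ Δ x₀ F F' E good T x s g u v)
    (hρ : 0 ≤ ρ) (hη : 0 < η) (hε : 0 < ε) (hL : 0 ≤ L) (hD₀ : 0 < D₀) (hD₁ : 0 < D₁)
    {A₀ A₁ c₁ c₂ : ℝ} (hA₀ : A₀ = 2 * D₀ + 2 * (L * ρ) ^ 2) (hA₁ : A₁ = 2 * D₁)
    (hc₁ : c₁ = L * η + (32 * A₁ ^ 2 + 2 * A₁) * (L * η) ^ 2 / ε)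
    (hc₂ : c₂ = 2 * (L * ρ) ^ 2 / ε) {t : ℕ} (ht : t < T) :
    E (fun k => F (x (t + 1) k)
        + η * ((2 * A₀ + 2 * A₁ * F' (x (t + 1) k) ^ 2) / √(v (t + 1) k)))
      + η / 2 * E (fun k => F' (x t k) ^ 2 / √(v t k))
      ≤ E (fun k => F (x t k) + η * ((2 * A₀ + 2 * A₁ * F' (x t k) ^ 2) / √(v t k)))
        + η * (c₁ * E (fun k => g t k ^ 2 / v (t + 1) k)
          + c₂ * E (fun k => s t k ^ 2 / u (t + 1) k)) := by
  have hA₀' : 0 < A₀ := by rw [hA₀]; positivity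
  have hA₁' : 0 < A₁ := by rw [hA₁]; positivity
  set P : ℕ → K → ℝ := fun t k =>
    F (x t k) + η * ((2 * A₀ + 2 * A₁ * F' (x t k) ^ 2) / √(v t k)) with hP
  set Q : K → ℝ := fun k => F' (x t k) ^ 2 / √(v t k) with hQ
  -- The Young coefficient of `s t ^ 2`; it involves only `x t` and `v t`, as the second-moment
  -- hypothesis requires.
  set φ : ℝ → ℝ → ℝ := fun y z => F' y ^ 2 / (4 * ((A₀ + A₁ * F' y ^ 2) * √z)) with hφ
  set N : K → ℝ := fun k => F' (x t k) / √(v t k) * s t k with hN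
  set R : K → ℝ := fun k => φ (x t k) (v t k) * s t k ^ 2 with hR
  set R' : K → ℝ := fun k => φ (x t k) (v t k) with hR'
  set G : K → ℝ := fun k => g t k ^ 2 / v (t + 1) k with hG
  set U : K → ℝ := fun k => s t k ^ 2 / u (t + 1) k with hU
  have hφ0 : ∀ y z, 0 ≤ φ y z := fun y z => by simp only [hφ]; positivity
  have h1 : E (P (t + 1)) ≤ E (P t + η • (-N + (1 / 4 : ℝ) • Q + R + (L * ρ) ^ 2 • R' + c₁ • G
      + c₂ • U)) := by
    apply h.mono
    intro k hk
    have hr := h.run k hk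
    have hv := h.pos_v hε hk ht.le
    have hv' := h.pos_v hε hk (t := t + 1) ht
    have hu' : 0 < u (t + 1) k := (by positivity : 0 < ε ^ 2).trans_le (hr.sq_le_u (t := t + 1) ht)
    have hx := hr.x_succ t ht
    have hd := le_add_deriv_mul_add_sq h.hasDerivAt h.lipschitz (x (t + 1) k) (x t k)
    have hd' := h.lipschitz (x (t + 1) k) (x t k)
    have hx' : x (t + 1) k - x t k = -(η * (g t k / √(v (t + 1) k))) := by rw [hx]; ring
    rw [hx'] at hd hd'
    have := potential_step (q := √(v t k)) (q' := √(v (t + 1) k)) (p := √(u (t + 1) k)) (ε := ε)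
      (a := F' (x t k)) (a' := F' (x (t + 1) k)) (s := s t k) (g := g t k) (η := η) (c := L * ρ)
      (κ := L * η) hA₀' hA₁'.le hη hε (hr.le_sqrt_v ht.le)
      (Real.sqrt_le_sqrt (by have := hr.v_succ t ht; nlinarith [sq_nonneg (g t k)]))
      (Real.sqrt_pos.mpr hu')
      ((hr.close t ht).trans_eq (mul_assoc _ _ _).symm) (hr.g_sq_le hε hL hρ ht)
      (hd'.trans_eq (by
        rw [abs_neg, abs_mul, abs_of_pos hη, abs_div, abs_of_nonneg (Real.sqrt_nonneg _)]
        ring)) hd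
    rw [Real.sq_sqrt hv'.le, Real.sq_sqrt hu'.le, ← hc₁, ← hc₂] at this
    simp only [Pi.add_apply, Pi.smul_apply, Pi.neg_apply, smul_eq_mul,
      hP, hN, hQ, hR, hR', hG, hU, hφ]
    linarith
  have h2 : E N = E Q := by
    rw [hN, h.mean t ht (fun y z => F' y / √z)]
    congr 1; ext k; simp only [hQ]; ring
  have h3 : E R ≤ E ((1 / 8 : ℝ) • Q - (L * ρ) ^ 2 • R') := by
    refine (h.second t ht φ hφ0).trans_eq ?_
    congr 1; ext k
    simp only [Pi.sub_apply, Pi.smul_apply, smul_eq_mul, hQ, hR', hφ]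
    have hM : 0 < A₀ + A₁ * F' (x t k) ^ 2 := by positivity
    -- This identity dictates `A₀` and `A₁`: half of `M` covers the noise, and the subtracted `(L *
    -- ρ) ^ 2` cancels the perturbation term `R'`.
    have e : D₀ + D₁ * F' (x t k) ^ 2 = (A₀ + A₁ * F' (x t k) ^ 2) / 2 - (L * ρ) ^ 2 := by
      rw [hA₀, hA₁]; ring
    rw [e]
    set M := A₀ + A₁ * F' (x t k) ^ 2
    set q := √(v t k)
    have : F' (x t k) ^ 2 / (4 * (M * q)) * (M / 2) = 1 / 8 * (F' (x t k) ^ 2 / q) := by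
      by_cases hq : q = 0
      · simp [hq]
      · field_simp; ring
    linarith
  have h4 : 0 ≤ E Q := by
    have := h.mono 0 Q (fun k _ => by simp only [hQ, Pi.zero_apply]; positivity)
    simpa using this
  simp only [map_add, map_smul, map_neg, map_sub, smul_eq_mul] at h1 h3
  have h5 : η * (-E N + 1 / 4 * E Q + E R + (L * ρ) ^ 2 * E R' + c₁ * E G + c₂ * E U)
      ≤ η * (-(1 / 2) * E Q + c₁ * E G + c₂ * E U) := by
    apply mul_le_mul_of_nonneg_left _ hη.le
    linarith
  linarith

/-- Telescoping of the potential. The shift `A₀ * (T + 1)` inside the logarithm absorbs the gap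
between `u` and `v`, and is the one used in `sqrt_le`. -/
theorem sum_sq_le (h : IsRandomScalarRun ρ η ε L D₀ D₁ Δ x₀ F F' E good T x s g u v)
    (hρ : 0 ≤ ρ) (hη : 0 < η) (hε : 0 < ε) (hL : 0 ≤ L) (hD₀ : 0 < D₀) (hD₁ : 0 < D₁)
    {A₀ A₁ c₁ c₂ : ℝ} (hA₀ : A₀ = 2 * D₀ + 2 * (L * ρ) ^ 2) (hA₁ : A₁ = 2 * D₁)
    (hc₁ : c₁ = L * η + (32 * A₁ ^ 2 + 2 * A₁) * (L * η) ^ 2 / ε)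
    (hc₂ : c₂ = 2 * (L * ρ) ^ 2 / ε) :
    η / 2 * ∑ t ∈ Finset.range T, E (fun k => F' (x t k) ^ 2 / √(v t k))
      ≤ Δ + η * ((2 * A₀ + 2 * A₁ * (4 * (L + 1) * Δ)) / ε)
        + η * ((c₁ + c₂) * (E (fun k => Real.log (v T k + A₀ * (T + 1))) + Real.log 2
          - Real.log (ε ^ 2))) := by
  have hA₀' : 0 < A₀ := by rw [hA₀]; positivity
  have hA₁' : 0 < A₁ := by rw [hA₁]; positivity
  have hc₁' : 0 ≤ c₁ := by rw [hc₁]; positivity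
  have hc₂' : 0 ≤ c₂ := by rw [hc₂]; positivity
  set P : ℕ → K → ℝ := fun t k =>
    F (x t k) + η * ((2 * A₀ + 2 * A₁ * F' (x t k) ^ 2) / √(v t k)) with hP
  set W : K → ℝ := fun k => Real.log (v T k + A₀ * (T + 1)) with hW
  have h1 : ∀ t ≤ T, E (P t) + η / 2 * ∑ i ∈ Finset.range t, E (fun k => F' (x i k) ^ 2 / √(v i k))
      ≤ E (P 0) + η * (c₁ * ∑ i ∈ Finset.range t, E (fun k => g i k ^ 2 / v (i + 1) k)
          + c₂ * ∑ i ∈ Finset.range t, E (fun k => s i k ^ 2 / u (i + 1) k)) := by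
    intro t
    induction t with
    | zero => simp
    | succ t ih =>
      intro ht
      have := h.potential_decrease hρ hη hε hL hD₀ hD₁ hA₀ hA₁ hc₁ hc₂ ht
      simp only [Finset.sum_range_succ]
      linarith [ih (Nat.le_of_succ_le ht)]
  -- The final penalty is nonnegative and is dropped; the initial one has `√v = ε` and its slope is
  -- bounded through `Δ` by `deriv_sq_le`.
  have h2 : E (P 0) ≤ E (P T) + (Δ + η * ((2 * A₀ + 2 * A₁ * (4 * (L + 1) * Δ)) / ε)) := by
    rw [← h.const (Δ + η * ((2 * A₀ + 2 * A₁ * (4 * (L + 1) * Δ)) / ε)), ← map_add]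
    apply h.mono
    intro k hk
    have hr := h.run k hk
    have hx := hr.x_zero
    have hv := hr.v_zero
    have hd := deriv_sq_le hL h.hasDerivAt h.lipschitz h.gap
    simp only [Pi.add_apply, hP, hx, hv, Real.sqrt_sq hε.le]
    have e1 := h.gap (x T k)
    have e2 : η * ((2 * A₀ + 2 * A₁ * F' x₀ ^ 2) / ε)
        ≤ η * ((2 * A₀ + 2 * A₁ * (4 * (L + 1) * Δ)) / ε) := by gcongr
    have e3 : 0 ≤ η * ((2 * A₀ + 2 * A₁ * F' (x T k) ^ 2) / √(v T k)) := by positivity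
    linarith
  have hsum : ∀ X : ℕ → K → ℝ, (∀ k ∈ good, ∑ i ∈ Finset.range T, X i k
      ≤ W k + (Real.log 2 - Real.log (ε ^ 2))) →
      ∑ i ∈ Finset.range T, E (X i) ≤ E W + (Real.log 2 - Real.log (ε ^ 2)) := by
    intro X hX
    rw [← h.const (Real.log 2 - Real.log (ε ^ 2)), ← map_add, ← map_sum]
    apply h.mono
    intro k hk
    simpa using hX k hk
  have h3 := hsum (fun i k => g i k ^ 2 / v (i + 1) k) (by
    intro k hk
    have hv := h.pos_v hε hk le_rfl
    have e1 := (h.run k hk).sum_g_le hε le_rfl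
    have e2 : Real.log (v T k) ≤ W k :=
      Real.log_le_log hv (by have : 0 ≤ A₀ * (T + 1) := by positivity
                             linarith)
    have e3 : 0 ≤ Real.log 2 := Real.log_nonneg (by norm_num)
    linarith)
  have h4 := hsum (fun i k => s i k ^ 2 / u (i + 1) k) (by
    intro k hk
    have hr := h.run k hk
    have hv := h.pos_v hε hk le_rfl
    have hu : 0 < u T k := (by positivity : 0 < ε ^ 2).trans_le (hr.sq_le_u le_rfl)
    have e1 := hr.sum_s_le hε le_rfl
    have hw : 0 < v T k + A₀ * (T + 1) := by positivity
    have e2 : Real.log (u T k) ≤ Real.log (2 * (v T k + A₀ * (T + 1))) := by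
      apply Real.log_le_log hu
      have e4 := hr.u_le hε hL hρ le_rfl
      have e5 : 2 * (L * ρ) ^ 2 * T ≤ A₀ * T := by
        gcongr; rw [hA₀]; linarith
      have e6 : 0 ≤ A₀ * T := by positivity
      linarith
    rw [Real.log_mul (by norm_num) hw.ne'] at e2
    simp only [hW]
    linarith)
  have h5 := mul_le_mul_of_nonneg_left h3 hc₁'
  have h6 := mul_le_mul_of_nonneg_left h4 hc₂'
  have h7 := mul_le_mul_of_nonneg_left (add_le_add h5 h6) hη.le
  have h8 := h1 T le_rfl
  linarith

/-- Each increment of the root is at most the increment of the accumulator over the old root, which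
is independent of the new sample. The affine noise bound then splits it into a `1/√(t + 1)` part and
a multiple of `F'²/√v`. -/
theorem sqrt_le (h : IsRandomScalarRun ρ η ε L D₀ D₁ Δ x₀ F F' E good T x s g u v)
    (hρ : 0 ≤ ρ) (hε : 0 < ε) (hL : 0 ≤ L) (hD₀ : 0 < D₀) (hD₁ : 0 < D₁)
    {A₀ A₁ : ℝ} (hA₀ : A₀ = 2 * D₀ + 2 * (L * ρ) ^ 2) (hA₁ : A₁ = 2 * D₁) :
    E (fun k => √(v T k + A₀ * (T + 1)))
      ≤ √(ε ^ 2 + A₀) + 4 * √A₀ * √T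
        + A₁ * ∑ t ∈ Finset.range T, E (fun k => F' (x t k) ^ 2 / √(v t k)) := by
  have hA₀' : 0 < A₀ := by rw [hA₀]; positivity
  have hA₁' : 0 < A₁ := by rw [hA₁]; positivity
  -- The deterministic drift guarantees `w t ≥ A₀ (t + 1)`, so the constant noise contributes only
  -- `O(√T)`.
  set w : ℕ → K → ℝ := fun t k => v t k + A₀ * (t + 1) with hw
  have hstep : ∀ t < T, E (fun k => √(w (t + 1) k)) ≤ E (fun k => √(w t k))
      + 2 * √A₀ * (1 / √((t : ℝ) + 1)) + A₁ * E (fun k => F' (x t k) ^ 2 / √(v t k)) := by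
    intro t ht
    set φ : ℝ → ℝ → ℝ := fun _ z => 2 / √(z + A₀ * (t + 1)) with hφ
    set B : K → ℝ := fun k => √(w t k) with hB
    set R : K → ℝ := fun k => φ (x t k) (v t k) * s t k ^ 2 with hR
    set R' : K → ℝ := fun k => (2 * (L * ρ) ^ 2 + A₀) / √(w t k) with hR'
    set Q : K → ℝ := fun k => F' (x t k) ^ 2 / √(v t k) with hQ
    have h1 : E (fun k => √(w (t + 1) k)) ≤ E (B + R + R') := by
      apply h.mono
      intro k hk
      have hr := h.run k hk
      have hv := h.pos_v hε hk ht.le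
      have hg := hr.g_sq_le hε hL hρ ht
      have hwt : 0 < w t k := by simp only [hw]; positivity
      have e : w (t + 1) k = w t k + (g t k ^ 2 + A₀) := by
        have := hr.v_succ t ht
        simp only [hw, this]; push_cast; ring
      rw [e]
      refine (sqrt_add_le hwt (by positivity)).trans ?_
      simp only [Pi.add_apply, hB, hR, hR', hφ, add_assoc]
      gcongr
      calc (g t k ^ 2 + A₀) / √(w t k)
          ≤ ((2 * s t k ^ 2 + 2 * (L * ρ) ^ 2) + A₀) / √(w t k) := by gcongr
        _ = _ := by simp only [hw]; ring
    have h2 : E R ≤ E (fun k => φ (x t k) (v t k) * (D₀ + D₁ * F' (x t k) ^ 2)) :=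
      h.second t ht φ (fun y z => by simp only [hφ]; positivity)
    have h3 : E ((fun k => φ (x t k) (v t k) * (D₀ + D₁ * F' (x t k) ^ 2)) + R')
        ≤ E ((fun _ => 2 * √A₀ * (1 / √((t : ℝ) + 1))) + A₁ • Q) := by
      apply h.mono
      intro k hk
      have hv := h.pos_v hε hk ht.le
      have hwt : 0 < w t k := by simp only [hw]; positivity
      simp only [Pi.add_apply, Pi.smul_apply, smul_eq_mul, hR', hQ, hφ]
      have e : 2 / √(v t k + A₀ * (t + 1)) * (D₀ + D₁ * F' (x t k) ^ 2)
          + (2 * (L * ρ) ^ 2 + A₀) / √(w t k)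
          = 2 * (A₀ / √(w t k)) + A₁ * (F' (x t k) ^ 2 / √(w t k)) := by
        change 2 / √(w t k) * _ + _ = _
        rw [hA₁]
        have : D₀ = (A₀ - 2 * (L * ρ) ^ 2) / 2 := by rw [hA₀]; ring
        rw [this]; ring
      rw [e]
      have e1 : A₀ / √(w t k) ≤ √A₀ * (1 / √((t : ℝ) + 1)) := by
        calc A₀ / √(w t k) ≤ A₀ / √(A₀ * (t + 1)) := by
              gcongr; simp only [hw]; linarith
          _ = _ := by
              rw [Real.sqrt_mul hA₀'.le]
              have : 0 < √A₀ := Real.sqrt_pos.mpr hA₀'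
              have h' : 0 < √((t : ℝ) + 1) := by positivity
              field_simp
              rw [Real.sq_sqrt hA₀'.le]
      have e2 : F' (x t k) ^ 2 / √(w t k) ≤ F' (x t k) ^ 2 / √(v t k) := by
        have : 0 < √(v t k) := Real.sqrt_pos.mpr hv
        gcongr
        simp only [hw]
        have : 0 ≤ A₀ * ((t : ℝ) + 1) := by positivity
        linarith
      have e3 := mul_le_mul_of_nonneg_left e2 hA₁'.le
      linarith
    simp only [map_add, map_smul, smul_eq_mul, h.const] at h1 h3
    linarith
  have hind : ∀ t ≤ T, E (fun k => √(w t k)) ≤ √(ε ^ 2 + A₀)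
      + 2 * √A₀ * ∑ i ∈ Finset.range t, 1 / √((i : ℝ) + 1)
      + A₁ * ∑ i ∈ Finset.range t, E (fun k => F' (x i k) ^ 2 / √(v i k)) := by
    intro t
    induction t with
    | zero =>
      intro _
      simp only [Finset.range_zero, Finset.sum_empty, mul_zero, add_zero]
      rw [← h.const (√(ε ^ 2 + A₀))]
      apply h.mono
      intro k hk
      have := (h.run k hk).v_zero
      simp [hw, this]
    | succ t ih =>
      intro ht
      simp only [Finset.sum_range_succ]
      linarith [ih (Nat.le_of_succ_le ht), hstep t ht]
  have h1 := hind T le_rfl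
  have h2 := mul_le_mul_of_nonneg_left (sum_one_div_sqrt_le T) (by positivity : 0 ≤ 2 * √A₀)
  simp only [hw] at h1
  linarith

/-- The tangent line of the logarithm at `c` plays the role of Jensen's inequality; `c` stays free
because it is used at two values. -/
theorem log_le (h : IsRandomScalarRun ρ η ε L D₀ D₁ Δ x₀ F F' E good T x s g u v)
    (hε : 0 < ε) {A₀ c : ℝ} (hA₀ : 0 ≤ A₀) (hc : 0 < c) :
    E (fun k => Real.log (v T k + A₀ * (T + 1)))
      ≤ 2 * (E (fun k => √(v T k + A₀ * (T + 1))) / c + Real.log c) := by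
  set Y : K → ℝ := fun k => √(v T k + A₀ * (T + 1)) with hY
  have h1 : E (fun k => Real.log (v T k + A₀ * (T + 1)))
      ≤ E ((2 / c) • Y + fun _ => 2 * Real.log c) := by
    apply h.mono
    intro k hk
    have hv := h.pos_v hε hk le_rfl
    have hw : 0 < v T k + A₀ * (T + 1) := by positivity
    have hs : 0 < √(v T k + A₀ * (T + 1)) := Real.sqrt_pos.mpr hw
    have e1 : Real.log (v T k + A₀ * (T + 1)) = 2 * Real.log (√(v T k + A₀ * (T + 1))) := by
      rw [Real.log_sqrt hw.le]; ring
    have e2 := Real.log_le_sub_one_of_pos (div_pos hs hc)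
    rw [Real.log_div hs.ne' hc.ne'] at e2
    simp only [Pi.add_apply, Pi.smul_apply, smul_eq_mul, hY]
    rw [e1]
    have e3 : 2 / c * √(v T k + A₀ * (T + 1)) = 2 * (√(v T k + A₀ * (T + 1)) / c) := by ring
    linarith
  simp only [map_add, map_smul, smul_eq_mul, h.const] at h1
  have e : 2 / c * E Y = 2 * (E Y / c) := by ring
  linarith

/-- AM-GM with weight `θ` on `|F'| = (|F'|/v^{1/4}) · v^{1/4}`, then monotonicity of `v` in time. -/
theorem sum_abs_le (h : IsRandomScalarRun ρ η ε L D₀ D₁ Δ x₀ F F' E good T x s g u v)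
    (hε : 0 < ε) {A₀ θ : ℝ} (hA₀ : 0 ≤ A₀) (hθ : 0 < θ) :
    ∑ t ∈ Finset.range T, E (fun k => |F' (x t k)|)
      ≤ 1 / 2 * (θ * ∑ t ∈ Finset.range T, E (fun k => F' (x t k) ^ 2 / √(v t k))
        + T * E (fun k => √(v T k + A₀ * (T + 1))) / θ) := by
  set Y : K → ℝ := fun k => √(v T k + A₀ * (T + 1)) with hY
  have h1 : ∀ t ∈ Finset.range T, E (fun k => |F' (x t k)|)
      ≤ θ / 2 * E (fun k => F' (x t k) ^ 2 / √(v t k)) + 1 / (2 * θ) * E Y := by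
    intro t ht
    have ht' := (Finset.mem_range.mp ht).le
    simp only [← smul_eq_mul, ← map_smul, ← map_add]
    apply h.mono
    intro k hk
    have hv := h.pos_v hε hk ht'
    have hq : 0 < √(v t k) := Real.sqrt_pos.mpr hv
    have hqY : √(v t k) ≤ Y k := by
      apply Real.sqrt_le_sqrt
      have := (h.run k hk).v_le_last ht'
      have : 0 ≤ A₀ * ((T : ℝ) + 1) := by positivity
      linarith
    simp only [Pi.add_apply, Pi.smul_apply, smul_eq_mul]
    have e1 : 1 / (2 * θ) * √(v t k) ≤ 1 / (2 * θ) * Y k := by gcongr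
    have e2 : θ / 2 * (F' (x t k) ^ 2 / √(v t k)) + 1 / (2 * θ) * √(v t k) - |F' (x t k)|
        = (θ * |F' (x t k)| - √(v t k)) ^ 2 / (2 * θ * √(v t k)) := by
      rw [← sq_abs (F' (x t k))]
      field_simp; ring
    have e3 : 0 ≤ (θ * |F' (x t k)| - √(v t k)) ^ 2 / (2 * θ * √(v t k)) := by positivity
    linarith
  refine (Finset.sum_le_sum h1).trans_eq ?_
  rw [Finset.sum_add_distrib, ← Finset.mul_sum, Finset.sum_const, Finset.card_range, nsmul_eq_mul]
  field_simp

end IsRandomScalarRun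

/-- Solving the coupled inequalities between the weighted sum of squared gradients `S` and the
expected root `Y` of the accumulator. -/
theorem exists_bound_of_coupled (K₀ K₁ k₀ k₁ A : ℝ) (hK₁ : 0 ≤ K₁) (hk₀ : 0 ≤ k₀)
    (hk₁ : 0 ≤ k₁) (hA : 0 ≤ A) :
    ∃ C : ℝ, 0 ≤ C ∧ ∀ r S Y : ℝ, √2 ≤ r → Y ≤ k₀ + k₁ * r + A * S →
      (∀ c, 0 < c → S ≤ K₀ + K₁ * (Y / c + Real.log c)) →
      S ≤ C * Real.log r ∧ Y ≤ C * r * Real.log r := by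
  -- At this `c` the feedback `A K₁ Y / c₀` is at most `Y / 2` and can be absorbed, giving `Y =
  -- O(r)`.
  set c₀ := 2 * A * K₁ + 1 with hc₀
  have hc₀' : 0 < c₀ := by positivity
  set b := |K₀ + K₁ * Real.log c₀| with hb
  set M := 2 * (k₀ + k₁ + A * b) with hM
  have hM0 : 0 ≤ M := by positivity
  have hlog : 0 < Real.log √2 := Real.log_pos (by
    rw [show (1 : ℝ) = √1 by simp]; exact Real.sqrt_lt_sqrt (by norm_num) (by norm_num))
  set l := Real.log √2 with hl
  set C₁ := (|K₀| + K₁ * M) / l + K₁ with hC₁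
  have hC₁0 : 0 ≤ C₁ := by positivity
  have hC₂0 : 0 ≤ M / l := by positivity
  refine ⟨C₁ + M / l, by positivity, fun r S Y hr hY hS => ?_⟩
  have hr1 : 1 ≤ r :=
    (Real.one_le_sqrt.mpr (by norm_num)).trans hr
  have hr0 : 0 < r := by linarith
  have hlr : l ≤ Real.log r := Real.log_le_log (by positivity) hr
  have hYr : Y ≤ M * r := by
    have h1 := hS c₀ hc₀'
    have h2 : A * S ≤ A * (K₁ * (Y / c₀)) + A * b := by
      have : S ≤ K₁ * (Y / c₀) + b := by
        have := le_abs_self (K₀ + K₁ * Real.log c₀)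
        linarith
      nlinarith
    by_cases hY0 : 0 ≤ Y
    · have h3 : A * (K₁ * (Y / c₀)) ≤ Y / 2 := by
        have : A * (K₁ * (Y / c₀)) = (A * K₁) * Y / c₀ := by ring
        rw [this, div_le_iff₀ hc₀', hc₀]
        nlinarith
      have h4 : k₀ + k₁ * r + A * b ≤ (k₀ + k₁ + A * b) * r := by
        have : 0 ≤ A * b := by positivity
        nlinarith
      rw [hM]; linarith
    · have : 0 ≤ M * r := by positivity
      linarith
  constructor
  -- Second use, with `c = r`: now `Y / r` is bounded and only `log r` remains. Constants are
  -- absorbed through `log r ≥ log √2 > 0`.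
  · have h1 := hS r hr0
    have h2 : Y / r ≤ M := (div_le_iff₀ hr0).mpr hYr
    have h3 : S ≤ (|K₀| + K₁ * M) + K₁ * Real.log r := by
      have := le_abs_self K₀
      have := mul_le_mul_of_nonneg_left h2 hK₁
      linarith
    have h4 : |K₀| + K₁ * M ≤ (|K₀| + K₁ * M) / l * Real.log r := by
      calc |K₀| + K₁ * M = (|K₀| + K₁ * M) / l * l := by field_simp
        _ ≤ _ := by gcongr
    have h5 : 0 ≤ M / l * Real.log r := by have := hlog.trans_le hlr; positivity
    rw [hC₁]; linarith
  · have h1 : M ≤ M / l * Real.log r := by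
      calc M = M / l * l := by field_simp
        _ ≤ _ := by gcongr
    have h2 : 0 ≤ C₁ * Real.log r := by have := hlog.trans_le hlr; positivity
    calc Y ≤ M * r := hYr
      _ ≤ (M / l * Real.log r + C₁ * Real.log r) * r := by gcongr; linarith
      _ = _ := by ring

/-- The convergence rate of LightSAM-II in one coordinate. -/
theorem exists_scalar_rate (ρ η ε L D₀ D₁ Δ : ℝ) (hρ : 0 ≤ ρ) (hη : 0 < η) (hε : 0 < ε)
    (hL : 0 ≤ L) (hD₀ : 0 < D₀) (hD₁ : 0 < D₁) :
    ∃ C : ℝ, ∀ (K : Type) (x₀ : ℝ) (F F' : ℝ → ℝ) (E : (K → ℝ) →ₗ[ℝ] ℝ) (good : Set K) (T : ℕ)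
      (x s g u v : ℕ → K → ℝ), 2 ≤ T →
      IsRandomScalarRun ρ η ε L D₀ D₁ Δ x₀ F F' E good T x s g u v →
      (1 / (T : ℝ)) * ∑ t ∈ Finset.range T, E (fun k => |F' (x t k)|)
        ≤ C * (Real.log T / (T : ℝ) ^ (1 / 4 : ℝ)) := by
  obtain ⟨A₀, hA₀⟩ : ∃ A₀, A₀ = 2 * D₀ + 2 * (L * ρ) ^ 2 := ⟨_, rfl⟩
  obtain ⟨A₁, hA₁⟩ : ∃ A₁, A₁ = 2 * D₁ := ⟨_, rfl⟩
  obtain ⟨c₁, hc₁⟩ : ∃ c₁, c₁ = L * η + (32 * A₁ ^ 2 + 2 * A₁) * (L * η) ^ 2 / ε := ⟨_, rfl⟩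
  obtain ⟨c₂, hc₂⟩ : ∃ c₂, c₂ = 2 * (L * ρ) ^ 2 / ε := ⟨_, rfl⟩
  have hA₀' : 0 < A₀ := by rw [hA₀]; positivity
  have hA₁' : 0 < A₁ := by rw [hA₁]; positivity
  have hc₁' : 0 ≤ c₁ := by rw [hc₁]; positivity
  have hc₂' : 0 ≤ c₂ := by rw [hc₂]; positivity
  obtain ⟨C, hC0, hC⟩ := exists_bound_of_coupled
    (2 / η * (Δ + η * ((2 * A₀ + 2 * A₁ * (4 * (L + 1) * Δ)) / ε))
      + 2 * (c₁ + c₂) * (Real.log 2 - Real.log (ε ^ 2))) (4 * (c₁ + c₂)) (√(ε ^ 2 + A₀))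
    (4 * √A₀) A₁ (by positivity) (by positivity) (by positivity) hA₁'.le
  refine ⟨C / 2, fun K x₀ F F' E good T x s g u v hT h => ?_⟩
  have hT' : (2 : ℝ) ≤ T := by exact_mod_cast hT
  have hT0 : (0 : ℝ) < T := by linarith
  set r := (T : ℝ) ^ (1 / 4 : ℝ) with hr
  have hr0 : 0 < r := Real.rpow_pos_of_pos hT0 _
  have hr4 : (T : ℝ) = r ^ 4 := by
    rw [hr, ← Real.rpow_natCast, ← Real.rpow_mul hT0.le]; norm_num
  have hr2 : √(T : ℝ) = r ^ 2 := by
    rw [hr4, show r ^ 4 = (r ^ 2) ^ 2 by ring, Real.sqrt_sq (by positivity)]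
  set S := ∑ t ∈ Finset.range T, E (fun k => F' (x t k) ^ 2 / √(v t k)) with hS
  set Y := E (fun k => √(v T k + A₀ * (T + 1))) with hY
  have h1 := h.sum_sq_le hρ hη hε hL hD₀ hD₁ hA₀ hA₁ hc₁ hc₂
  obtain ⟨hSC, hYC⟩ := hC (√T) S Y (Real.sqrt_le_sqrt hT')
    (h.sqrt_le hρ hε hL hD₀ hD₁ hA₀ hA₁) (by
      intro c hc
      have h2 := h.log_le (A₀ := A₀) hε hA₀'.le hc
      have h3 := mul_le_mul_of_nonneg_left h2 (by positivity : 0 ≤ 2 * (c₁ + c₂))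
      have h4 := mul_le_mul_of_nonneg_left h1 (by positivity : 0 ≤ 2 / η)
      have e1 : 2 / η * (η / 2 * S) = S := by field_simp
      have e2 : ∀ z, 2 / η * (η * z) = 2 * z := fun z => by field_simp
      rw [e1, mul_add, e2] at h4
      linarith)
  have hlog : Real.log √(T : ℝ) = Real.log T / 2 := Real.log_sqrt hT0.le
  rw [hlog] at hSC hYC
  -- `θ = T^(3/4)` balances `θ S` against `T Y / θ`: both are of order `T^(3/4) log T`.
  have h5 := h.sum_abs_le (A₀ := A₀) hε hA₀'.le (pow_pos hr0 3)
  calc (1 / (T : ℝ)) * ∑ t ∈ Finset.range T, E (fun k => |F' (x t k)|)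
      ≤ (1 / (T : ℝ)) * (1 / 2 * (r ^ 3 * S + T * Y / r ^ 3)) := by gcongr
    _ ≤ (1 / (T : ℝ)) * (1 / 2 * (r ^ 3 * (C * (Real.log T / 2))
          + T * (C * √T * (Real.log T / 2)) / r ^ 3)) := by gcongr
    _ = C / 2 * (Real.log T / r) := by
        rw [hr2]
        set l := Real.log (T : ℝ)
        rw [hr4]; field_simp; ring

end LightSAM

/-! ### Expectations of functions of finitely many minibatches. -/

namespace LightSAM

section Sampling

variable {β : Type*}

/-- The first `T` terms of a sequence, continued by a constant. -/
def truncate (T : ℕ) (B₀ : β) (B : ℕ → β) : ℕ → β := fun t => if t < T then B t else B₀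

theorem truncate_of_lt {T : ℕ} {B₀ : β} {B : ℕ → β} {t : ℕ} (h : t < T) :
    truncate T B₀ B t = B t := if_pos h

/-- The continuation by a constant of a finite sequence. -/
def extend (T : ℕ) (B₀ : β) (h : Finset.range T → β) : ℕ → β :=
  fun t => if ht : t < T then h ⟨t, Finset.mem_range.mpr ht⟩ else B₀

theorem extend_restrict (T : ℕ) (B₀ : β) (B : ℕ → β) :
    extend T B₀ (fun i : Finset.range T => B i) = truncate T B₀ B := by
  ext t; by_cases h : t < T <;> simp [extend, truncate, h]

variable {Ω : Type*} [MeasurableSpace Ω] {μ : Measure Ω} [Fintype β] [MeasurableSpace β]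
  [MeasurableSingletonClass β] {ξ : ℕ → Ω → β}

/-- After truncation the function factors through the finite set of `T`-tuples, so no measurability
or boundedness of `Φ` is needed. -/
theorem integrable_truncate [IsFiniteMeasure μ] (hξ : ∀ t, Measurable (ξ t)) (T : ℕ) (B₀ : β)
    (Φ : (ℕ → β) → ℝ) : Integrable (fun ω => Φ (truncate T B₀ (ξ · ω))) μ := by
  have hm : Measurable fun ω => fun i : Finset.range T => ξ i ω :=
    measurable_pi_lambda _ fun i => hξ i
  have := (Integrable.of_finite (μ := μ.map fun ω => fun i : Finset.range T => ξ i ω)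
    (f := Φ ∘ extend T B₀)).comp_measurable hm
  refine this.congr (Filter.Eventually.of_forall fun ω => ?_)
  exact congrArg Φ (extend_restrict T B₀ fun i => ξ i ω)

/-- The expectation of a function of the first `T` samples. -/
noncomputable def pathExpectation (μ : Measure Ω) [IsFiniteMeasure μ] (hξ : ∀ t, Measurable (ξ t))
    (T : ℕ) (B₀ : β) : ((ℕ → β) → ℝ) →ₗ[ℝ] ℝ where
  toFun Φ := ∫ ω, Φ (truncate T B₀ (ξ · ω)) ∂μ
  map_add' Φ Ψ :=
    integral_add (integrable_truncate hξ T B₀ Φ) (integrable_truncate hξ T B₀ Ψ)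
  map_smul' c _ := integral_const_mul c _

theorem pathExpectation_apply [IsFiniteMeasure μ] (hξ : ∀ t, Measurable (ξ t)) (T : ℕ) (B₀ : β)
    (Φ : (ℕ → β) → ℝ) :
    pathExpectation μ hξ T B₀ Φ = ∫ ω, Φ (truncate T B₀ (ξ · ω)) ∂μ := rfl

theorem pathExpectation_mono [IsFiniteMeasure μ] (hξ : ∀ t, Measurable (ξ t)) {T : ℕ} {B₀ : β}
    {Φ Ψ : (ℕ → β) → ℝ}
    (h : ∀ᵐ ω ∂μ, Φ (truncate T B₀ (ξ · ω)) ≤ Ψ (truncate T B₀ (ξ · ω))) :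
    pathExpectation μ hξ T B₀ Φ ≤ pathExpectation μ hξ T B₀ Ψ :=
  integral_mono_ae (integrable_truncate hξ T B₀ Φ) (integrable_truncate hξ T B₀ Ψ) h

theorem integral_comp_eq_sum [IsFiniteMeasure μ] {X : Ω → β} (hX : Measurable X) (h : β → ℝ) :
    ∫ ω, h (X ω) ∂μ = ∑ B, μ.real (X ⁻¹' {B}) * h B := by
  rw [← integral_map (f := h) hX.aemeasurable (Integrable.of_finite).aestronglyMeasurable,
    integral_fintype Integrable.of_finite]
  refine Finset.sum_congr rfl fun B _ => ?_
  rw [map_measureReal_apply hX (measurableSet_singleton B), smul_eq_mul]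

theorem sum_measureReal_preimage [IsProbabilityMeasure μ] {X : Ω → β} (hX : Measurable X) :
    ∑ B, μ.real (X ⁻¹' {B}) = 1 := by
  have := integral_comp_eq_sum (μ := μ) hX (fun _ => 1)
  simpa using this.symm

/-- Averaging out a sample that is independent of the past. -/
theorem pathExpectation_next [IsFiniteMeasure μ] (hξ : ∀ t, Measurable (ξ t)) (hi : iIndepFun ξ μ)
    {T t : ℕ} (ht : t < T) (B₀ : β) (Ψ : (ℕ → β) → β → ℝ)
    (hΨ : ∀ B B' : ℕ → β, (∀ s < t, B s = B' s) → Ψ B = Ψ B') :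
    pathExpectation μ hξ T B₀ (fun k => Ψ k (k t))
      = pathExpectation μ hξ T B₀ (fun k => ∑ B, μ.real (ξ t ⁻¹' {B}) * Ψ k B) := by
  classical
  set E := pathExpectation μ hξ T B₀ with hE
  -- Splitting over the value of the `t`-th sample gives products of a function of the past and an
  -- indicator of the present, to which independence applies.
  have h1 : (fun k : ℕ → β => Ψ k (k t))
      = ∑ B, fun k : ℕ → β => Ψ k B * if k t = B then 1 else 0 := by
    ext k; simp
  have h2 : (fun k : ℕ → β => ∑ B, μ.real (ξ t ⁻¹' {B}) * Ψ k B)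
      = ∑ B, μ.real (ξ t ⁻¹' {B}) • fun k : ℕ → β => Ψ k B := by
    ext k; simp
  rw [h1, h2, map_sum, map_sum]
  refine Finset.sum_congr rfl fun B _ => ?_
  rw [map_smul, smul_eq_mul, hE, pathExpectation_apply, pathExpectation_apply]
  have hind := hi.indepFun_finset (Finset.range t) {t} (by simp) hξ
  have hind' := hind.comp (φ := fun h => Ψ (extend t B₀ h) B)
    (ψ := fun h => if h ⟨t, Finset.mem_singleton_self t⟩ = B then (1 : ℝ) else 0)
    .of_discrete .of_discrete
  have hm : Measurable fun ω => fun i : Finset.range t => ξ i ω :=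
    measurable_pi_lambda _ fun i => hξ i
  have hm' : Measurable fun ω => fun i : ({t} : Finset ℕ) => ξ i ω :=
    measurable_pi_lambda _ fun i => hξ i
  have := hind'.integral_fun_mul_eq_mul_integral
    ((Measurable.of_discrete.comp hm).aestronglyMeasurable)
    ((Measurable.of_discrete.comp hm').aestronglyMeasurable)
  have e' : ∀ ω, extend t B₀ (fun i : Finset.range t => ξ i ω) = truncate t B₀ (ξ · ω) :=
    fun ω => extend_restrict t B₀ (ξ · ω)
  simp only [Function.comp_apply, e'] at this
  have e : ∀ ω, Ψ (truncate t B₀ (ξ · ω)) = Ψ (truncate T B₀ (ξ · ω)) := fun ω =>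
    hΨ _ _ fun s hs => by rw [truncate_of_lt hs, truncate_of_lt (hs.trans ht)]
  simp only [e] at this
  simp only [truncate_of_lt ht]
  rw [this, mul_comm, integral_comp_eq_sum (hξ t) (fun B' => if B' = B then (1 : ℝ) else 0)]
  simp

end Sampling

/-! ### Unbiasedness, smoothness and separability of the objective. -/

section Objective

variable {d n b : ℕ} {f : Fin n → EuclideanSpace ℝ (Fin d) → ℝ}

theorem gradient_apply (F : EuclideanSpace ℝ (Fin d) → ℝ) (x : EuclideanSpace ℝ (Fin d))
    (l : Fin d) : gradient F x l = fderiv ℝ F x (EuclideanSpace.single l 1) := by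
  rw [← inner_gradient_left, EuclideanSpace.inner_single_right]; simp

variable {Ω : Type*} [MeasurableSpace Ω] {μ : Measure Ω} [IsProbabilityMeasure μ]
  {ξ : ℕ → Ω → Fin b → Fin n}

/-- The objective is the expected minibatch loss. -/
theorem IsMinibatchSampling.objective_eq_sum (h : IsMinibatchSampling μ ξ) (hb : 0 < b) (t : ℕ)
    (x : EuclideanSpace ℝ (Fin d)) :
    objective f x = ∑ B, μ.real (ξ t ⁻¹' {B}) * batchLoss f B x := by
  rw [← integral_comp_eq_sum (h.measurable t) (fun B => batchLoss f B x)]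
  have hj : ∀ j, Measurable fun ω => ξ t ω j := fun j =>
    (measurable_pi_apply j).comp (h.measurable t)
  have hint : ∀ j, Integrable (fun ω => f (ξ t ω j) x) μ := fun j =>
    (Integrable.of_finite (f := fun i => f i x)).comp_measurable (hj j)
  have e : ∀ j, ∫ ω, f (ξ t ω j) x ∂μ = objective f x := by
    intro j
    rw [integral_comp_eq_sum (hj j) (fun i => f i x), objective, Finset.mul_sum]
    refine Finset.sum_congr rfl fun i _ => ?_
    congr 1
    exact h.uniform t j i
  simp only [batchLoss]
  rw [integral_const_mul, integral_finsetSum _ fun j _ => hint j]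
  simp only [e, Finset.sum_const, Finset.card_univ, Fintype.card_fin, nsmul_eq_mul]
  have : (b : ℝ) ≠ 0 := by positivity
  field_simp

/-- An almost sure property holds at every atom. Batches of zero mass may violate it, but they enter
the sums below with weight zero. -/
theorem coordSmooth_batchLoss {L : ℝ} {t : ℕ}
    (hs : ∀ᵐ ω ∂μ, CoordSmooth L (batchLoss f (ξ t ω))) {B : Fin b → Fin n}
    (hB : μ.real (ξ t ⁻¹' {B}) ≠ 0) : CoordSmooth L (batchLoss f B) := by
  by_contra hcon
  apply hB
  rw [measureReal_eq_zero_iff]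
  refine measure_mono_null ?_ (ae_iff.mp hs)
  intro ω hω
  simp only [Set.mem_preimage, Set.mem_singleton_iff] at hω
  simpa [hω] using hcon

theorem IsMinibatchSampling.differentiable_objective (h : IsMinibatchSampling μ ξ) (hb : 0 < b)
    {L : ℝ} {t : ℕ} (hs : ∀ᵐ ω ∂μ, CoordSmooth L (batchLoss f (ξ t ω))) :
    Differentiable ℝ (objective f) := by
  rw [funext (h.objective_eq_sum hb t)]
  refine Differentiable.fun_sum fun B _ => ?_
  by_cases hB : μ.real (ξ t ⁻¹' {B}) = 0
  · simp [hB]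
  · exact (coordSmooth_batchLoss hs hB).1.const_mul _

/-- The minibatch gradients are unbiased. -/
theorem IsMinibatchSampling.gradient_objective (h : IsMinibatchSampling μ ξ) (hb : 0 < b)
    {L : ℝ} {t : ℕ} (hs : ∀ᵐ ω ∂μ, CoordSmooth L (batchLoss f (ξ t ω)))
    (x : EuclideanSpace ℝ (Fin d)) (l : Fin d) :
    gradient (objective f) x l
      = ∑ B, μ.real (ξ t ⁻¹' {B}) * gradient (batchLoss f B) x l := by
  rw [gradient_apply, funext (h.objective_eq_sum hb t), fderiv_fun_sum, sum_apply]
  · refine Finset.sum_congr rfl fun B _ => ?_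
    by_cases hB : μ.real (ξ t ⁻¹' {B}) = 0
    · simp [hB]
    · rw [fderiv_const_mul ((coordSmooth_batchLoss hs hB).1 x), gradient_apply]; rfl
  · intro B _
    by_cases hB : μ.real (ξ t ⁻¹' {B}) = 0
    · simp [hB]
    · exact ((coordSmooth_batchLoss hs hB).1 x).const_mul _

theorem IsMinibatchSampling.coordSmooth_objective (h : IsMinibatchSampling μ ξ) (hb : 0 < b)
    {L : ℝ} {t : ℕ} (hs : ∀ᵐ ω ∂μ, CoordSmooth L (batchLoss f (ξ t ω))) :
    CoordSmooth L (objective f) := by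
  refine ⟨h.differentiable_objective hb hs, fun x y l => ?_⟩
  rw [h.gradient_objective hb hs, h.gradient_objective hb hs, ← Finset.sum_sub_distrib]
  calc |∑ B, (μ.real (ξ t ⁻¹' {B}) * gradient (batchLoss f B) x l
          - μ.real (ξ t ⁻¹' {B}) * gradient (batchLoss f B) y l)|
      ≤ ∑ B, |μ.real (ξ t ⁻¹' {B}) * gradient (batchLoss f B) x l
          - μ.real (ξ t ⁻¹' {B}) * gradient (batchLoss f B) y l| := Finset.abs_sum_le_sum_abs _ _
    _ ≤ ∑ B, μ.real (ξ t ⁻¹' {B}) * (L * |x l - y l|) := by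
        refine Finset.sum_le_sum fun B _ => ?_
        rw [← mul_sub, abs_mul, abs_of_nonneg measureReal_nonneg]
        by_cases hB : μ.real (ξ t ⁻¹' {B}) = 0
        · simp [hB]
        · exact mul_le_mul_of_nonneg_left ((coordSmooth_batchLoss hs hB).2 x y l) measureReal_nonneg
    _ = L * |x l - y l| := by
        rw [← Finset.sum_mul, sum_measureReal_preimage (h.measurable t), one_mul]

/-- The line through `x₁` in the direction of the `l`-th coordinate, parametrized by that
coordinate. -/
noncomputable def coordLine (x₁ : EuclideanSpace ℝ (Fin d)) (l : Fin d) (z : ℝ) :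
    EuclideanSpace ℝ (Fin d) :=
  x₁ + (z - x₁ l) • EuclideanSpace.single l 1

theorem coordLine_apply_self (x₁ : EuclideanSpace ℝ (Fin d)) (l : Fin d) (z : ℝ) :
    coordLine x₁ l z l = z := by simp [coordLine]

theorem coordLine_self (x₁ : EuclideanSpace ℝ (Fin d)) (l : Fin d) :
    coordLine x₁ l (x₁ l) = x₁ := by simp [coordLine]

theorem hasDerivAt_coordLine {F : EuclideanSpace ℝ (Fin d) → ℝ} (hF : Differentiable ℝ F)
    (x₁ : EuclideanSpace ℝ (Fin d)) (l : Fin d) (z : ℝ) :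
    HasDerivAt (fun z => F (coordLine x₁ l z)) (gradient F (coordLine x₁ l z) l) z := by
  rw [gradient_apply]
  refine (hF (coordLine x₁ l z)).hasFDerivAt.comp_hasDerivAt z ?_
  have := (((hasDerivAt_id z).sub_const (x₁ l)).smul_const
    (EuclideanSpace.single l (1 : ℝ))).const_add x₁
  rwa [one_smul] at this

/-- Both points have the same `l`-th coordinate, so the smoothness bound is zero. This is the
separability that reduces the problem to scalar runs. -/
theorem CoordSmooth.gradient_coordLine {L : ℝ} {F : EuclideanSpace ℝ (Fin d) → ℝ}
    (hF : CoordSmooth L F) (x₁ x : EuclideanSpace ℝ (Fin d)) (l : Fin d) :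
    gradient F (coordLine x₁ l (x l)) l = gradient F x l := by
  have := hF.2 (coordLine x₁ l (x l)) x l
  rw [coordLine_apply_self, sub_self, abs_zero, mul_zero] at this
  exact sub_eq_zero.mp (abs_nonpos_iff.mp this)

end Objective

/-! ### Each coordinate of the algorithm as a scalar run. -/

section Algorithm

variable {d n b : ℕ} {ρ η ε : ℝ} {f : Fin n → EuclideanSpace ℝ (Fin d) → ℝ}
  {x₁ : EuclideanSpace ℝ (Fin d)}

theorem state_congr {B B' : ℕ → Fin b → Fin n} {t : ℕ} (h : ∀ s < t, B s = B' s) :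
    state ρ η ε f x₁ B t = state ρ η ε f x₁ B' t := by
  induction t with
  | zero => rfl
  | succ t ih =>
    simp only [state, ih fun s hs => h s (hs.trans t.lt_succ_self), h t t.lt_succ_self]

/-- The perturbed point at which iteration `t + 1` takes its second gradient. -/
noncomputable def perturbed (ρ η ε : ℝ) (f : Fin n → EuclideanSpace ℝ (Fin d) → ℝ)
    (x₁ : EuclideanSpace ℝ (Fin d)) (B : ℕ → Fin b → Fin n) (t : ℕ) : EuclideanSpace ℝ (Fin d) :=
  (state ρ η ε f x₁ B t).x + ρ • scaled (state ρ η ε f x₁ B (t + 1)).u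
    (gradient (batchLoss f (B t)) (state ρ η ε f x₁ B t).x)

theorem isScalarRun_state {L : ℝ} (hρ : 0 ≤ ρ) {T : ℕ} {B : ℕ → Fin b → Fin n}
    (hB : ∀ t < T, CoordSmooth L (batchLoss f (B t))) (l : Fin d) :
    IsScalarRun ρ η ε L (x₁ l) T (fun t => (state ρ η ε f x₁ B t).x l)
      (fun t => gradient (batchLoss f (B t)) (state ρ η ε f x₁ B t).x l)
      (fun t => gradient (batchLoss f (B t)) (perturbed ρ η ε f x₁ B t) l)
      (fun t => (state ρ η ε f x₁ B t).u l) (fun t => (state ρ η ε f x₁ B t).v l) where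
  x_zero := rfl
  u_zero := rfl
  v_zero := rfl
  u_succ _ _ := rfl
  v_succ _ _ := rfl
  x_succ t _ := rfl
  close t ht := by
    refine ((hB t ht).2 _ _ l).trans_eq ?_
    congr 1
    have : perturbed ρ η ε f x₁ B t l - (state ρ η ε f x₁ B t).x l
        = ρ * (gradient (batchLoss f (B t)) (state ρ η ε f x₁ B t).x l
          / √((state ρ η ε f x₁ B (t + 1)).u l)) := by
      simp [perturbed, scaled]
    rw [this, abs_mul, abs_of_nonneg hρ, abs_div, abs_of_nonneg (Real.sqrt_nonneg _)]

variable {Ω : Type*} [MeasurableSpace Ω] {μ : Measure Ω} [IsProbabilityMeasure μ]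
  {ξ : ℕ → Ω → Fin b → Fin n}

theorem IsMinibatchSampling.isRandomScalarRun (h : IsMinibatchSampling μ ξ) (hb : 0 < b)
    (hρ : 0 ≤ ρ) {L D₀ D₁ Δ : ℝ} (hΔ : ∀ y, objective f x₁ - objective f y ≤ Δ)
    (hs : ∀ t, ∀ᵐ ω ∂μ, CoordSmooth L (batchLoss f (ξ t ω)))
    (hv : ∀ t x l, ∫ ω, (gradient (batchLoss f (ξ t ω)) x l) ^ 2 ∂μ
      ≤ D₀ + D₁ * (gradient (objective f) x l) ^ 2) (T : ℕ) (B₀ : Fin b → Fin n) (l : Fin d) :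
    IsRandomScalarRun ρ η ε L D₀ D₁ Δ (x₁ l) (fun z => objective f (coordLine x₁ l z))
      (fun z => gradient (objective f) (coordLine x₁ l z) l)
      (pathExpectation μ h.measurable T B₀)
      {B | ∀ t < T, CoordSmooth L (batchLoss f (B t))} T
      (fun t B => (state ρ η ε f x₁ B t).x l)
      (fun t B => gradient (batchLoss f (B t)) (state ρ η ε f x₁ B t).x l)
      (fun t B => gradient (batchLoss f (B t)) (perturbed ρ η ε f x₁ B t) l)
      (fun t B => (state ρ η ε f x₁ B t).u l) (fun t B => (state ρ η ε f x₁ B t).v l) := by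
  have hobj := h.coordSmooth_objective hb (hs 0)
  refine ⟨hasDerivAt_coordLine hobj.1 x₁ l, fun y z => ?_, fun z => ?_, fun X Y hXY => ?_, ?_,
    fun B hB => isScalarRun_state hρ hB l, fun t ht φ => ?_, fun t ht φ hφ => ?_⟩
  · have := hobj.2 (coordLine x₁ l y) (coordLine x₁ l z) l
    rwa [coordLine_apply_self, coordLine_apply_self] at this
  · simp only [coordLine_self]
    exact hΔ _
  · refine pathExpectation_mono h.measurable ?_
    filter_upwards [ae_all_iff.mpr hs] with ω hω
    refine hXY _ fun t ht => ?_
    rw [truncate_of_lt ht]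
    exact hω t
  · rw [pathExpectation_apply]; simp
  · simp only [hobj.gradient_coordLine]
    refine (pathExpectation_next h.measurable h.indep ht B₀
      (fun k B => φ ((state ρ η ε f x₁ k t).x l) ((state ρ η ε f x₁ k t).v l)
        * gradient (batchLoss f B) (state ρ η ε f x₁ k t).x l)
      (fun B B' hBB => by rw [state_congr hBB])).trans ?_
    congr 1; ext k
    rw [h.gradient_objective hb (hs t), Finset.mul_sum]
    exact Finset.sum_congr rfl fun B _ => by ring
  · simp only [hobj.gradient_coordLine]
    refine (pathExpectation_next h.measurable h.indep ht B₀
      (fun k B => φ ((state ρ η ε f x₁ k t).x l) ((state ρ η ε f x₁ k t).v l)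
        * gradient (batchLoss f B) (state ρ η ε f x₁ k t).x l ^ 2)
      (fun B B' hBB => by rw [state_congr hBB])).trans_le ?_
    refine pathExpectation_mono h.measurable (Filter.Eventually.of_forall fun ω => ?_)
    set k := truncate T B₀ (ξ · ω)
    have e := hv t (state ρ η ε f x₁ k t).x l
    rw [integral_comp_eq_sum (h.measurable t)
      (fun B => gradient (batchLoss f B) (state ρ η ε f x₁ k t).x l ^ 2)] at e
    refine le_trans (le_of_eq ?_) (mul_le_mul_of_nonneg_left e (hφ _ _))
    rw [Finset.mul_sum]
    exact Finset.sum_congr rfl fun B _ => by ring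

end Algorithm

end LightSAM

/-! ### Summation over the coordinates. -/

theorem corollary2 (d : ℕ) (ρ η ε L D₀ D₁ Δ : ℝ) (hρ : 0 ≤ ρ) (hη : 0 < η) (hε : 0 < ε)
    (hL : 0 ≤ L) (hD₀ : 0 < D₀) (hD₁ : 0 < D₁) :
    ∃ C : ℝ, ∀ (n b : ℕ) (_ : 0 < b) (f : Fin n → EuclideanSpace ℝ (Fin d) → ℝ)
      (x₁ : EuclideanSpace ℝ (Fin d))
      (Ω : Type*) [MeasurableSpace Ω] (μ : Measure Ω) [IsProbabilityMeasure μ]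
      (ξ : ℕ → Ω → Fin b → Fin n),
      LightSAM.IsMinibatchSampling μ ξ →
      (∀ y, LightSAM.objective f x₁ - LightSAM.objective f y ≤ Δ) →
      (∀ t, ∀ᵐ ω ∂μ, LightSAM.CoordSmooth L (LightSAM.batchLoss f (ξ t ω))) →
      (∀ t x l, ∫ ω, (gradient (LightSAM.batchLoss f (ξ t ω)) x l) ^ 2 ∂μ
        ≤ D₀ + D₁ * (gradient (LightSAM.objective f) x l) ^ 2) →
      (∀ t, 1 ≤ t → Integrable (fun ω => LightSAM.l1Norm (gradient (LightSAM.objective f)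
        (LightSAM.iterate ρ η ε f x₁ (fun s => ξ s ω) t))) μ) ∧
      ∀ T : ℕ, 2 ≤ T →
        (1 / (T : ℝ)) * ∑ t ∈ Finset.Icc 1 T,
            ∫ ω, LightSAM.l1Norm (gradient (LightSAM.objective f)
              (LightSAM.iterate ρ η ε f x₁ (fun s => ξ s ω) t)) ∂μ
          ≤ C * (Real.log T / (T : ℝ) ^ (1 / 4 : ℝ)) := by
  obtain ⟨C, hC⟩ := LightSAM.exists_scalar_rate ρ η ε L D₀ D₁ Δ hρ hη hε hL hD₀ hD₁
  refine ⟨d * C, fun n b hb f x₁ Ω _ μ _ ξ h hΔ hs hv => ?_⟩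
  -- Supplies an arbitrary filler batch `ξ 0 ω₀` for the truncated sequences; `hstate` shows that it
  -- does not affect the first `T` iterations.
  obtain ⟨ω₀⟩ := nonempty_of_isProbabilityMeasure μ
  have hstate : ∀ {T t : ℕ}, t ≤ T → ∀ ω,
      (LightSAM.state ρ η ε f x₁ (LightSAM.truncate T (ξ 0 ω₀) (ξ · ω)) t).x
        = (LightSAM.state ρ η ε f x₁ (ξ · ω) t).x := by
    intro T t ht ω
    rw [LightSAM.state_congr fun s hs => LightSAM.truncate_of_lt (hs.trans_le ht)]
  have hint : ∀ t l, Integrable (fun ω =>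
      |gradient (LightSAM.objective f) (LightSAM.state ρ η ε f x₁ (ξ · ω) t).x l|) μ := by
    intro t l
    have := LightSAM.integrable_truncate (μ := μ) h.measurable t (ξ 0 ω₀)
      (fun k => |gradient (LightSAM.objective f) (LightSAM.state ρ η ε f x₁ k t).x l|)
    simpa only [hstate le_rfl] using this
  refine ⟨fun t _ => integrable_finsetSum _ fun l _ => hint (t - 1) l, fun T hT => ?_⟩
  have hobj := h.coordSmooth_objective hb (hs 0)
  have hsum : ∑ t ∈ Finset.Icc 1 T, ∫ ω, LightSAM.l1Norm (gradient (LightSAM.objective f)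
        (LightSAM.iterate ρ η ε f x₁ (fun s => ξ s ω) t)) ∂μ
      = ∑ l : Fin d, ∑ t ∈ Finset.range T, LightSAM.pathExpectation μ h.measurable T (ξ 0 ω₀)
          (fun k => |gradient (LightSAM.objective f)
            (LightSAM.coordLine x₁ l ((LightSAM.state ρ η ε f x₁ k t).x l)) l|) := by
    -- The weights at time `t ≥ 1` are those of the state after `t - 1` iterations, hence the shift
    -- of index.
    rw [Finset.sum_comm, Finset.range_eq_Ico, Finset.sum_Ico_eq_sum_range,
      ← Finset.Ico_add_one_right_eq_Icc, Finset.sum_Ico_eq_sum_range]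
    refine Finset.sum_congr (by simp) fun t ht => ?_
    have ht' : t ≤ T := by simp at ht; omega
    simp only [LightSAM.l1Norm, LightSAM.iterate, Nat.add_sub_cancel_left, zero_add]
    rw [integral_finsetSum _ fun l _ => hint t l]
    refine Finset.sum_congr rfl fun l _ => ?_
    simp only [LightSAM.pathExpectation_apply, hobj.gradient_coordLine, hstate ht']
  rw [hsum, Finset.mul_sum]
  calc ∑ l : Fin d, 1 / (T : ℝ) * ∑ t ∈ Finset.range T,
        LightSAM.pathExpectation μ h.measurable T (ξ 0 ω₀)
          (fun k => |gradient (LightSAM.objective f)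
            (LightSAM.coordLine x₁ l ((LightSAM.state ρ η ε f x₁ k t).x l)) l|)
      ≤ ∑ _l : Fin d, C * (Real.log T / (T : ℝ) ^ (1 / 4 : ℝ)) :=
        Finset.sum_le_sum fun l _ =>
          hC _ _ _ _ _ _ T _ _ _ _ _ hT (h.isRandomScalarRun hb hρ hΔ hs hv T (ξ 0 ω₀) l)
    _ = d * C * (Real.log T / (T : ℝ) ^ (1 / 4 : ℝ)) := by
        rw [Finset.sum_const, Finset.card_univ, Fintype.card_fin, nsmul_eq_mul, mul_assoc]
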